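/- Consider spinless fermions on a chain with an even number $M$ of sites, with creation and annihilation operators $\hat f_j^\dagger,\hat f_j$ ($j=1,\dots,M$) on the fermionic Fock space with vacuum $|0\rangle$. For each even $M$ let $(\Omega_M,p_M)$ be a finite probability space of disorder realizations (a one-point space in the absence of averaging). For each $\omega\in\Omega_M$ let $H^{(M,\omega)}$ be a Hermitian $M\times M$ matrix, and let $G^{(M)}$ be a complex $M\times N_M$ matrix with orthonormal columns. Fix $\hbar>0$, and put $\hat H_\omega=\sum_{i,j=1}^M \hat f_i^\dagger H^{(M,\omega)}_{ij}\hat f_j$, $$|\psi_\omega(t)\rangle=e^{-i\hat H_\omega t/\hbar}\prod_{\alpha=1}^{N_M}\Big(\sum_{j=1}^M \hat f_j^\dagger G^{(M)}_{j\alpha}\Big)|0\rangle,\qquad \hat\rho_\omega(t)=|\psi_\omega(t)\rangle\langle\psi_\omega(t)|,\qquad D^{\omega}_{ij}(t)=\mathrm{Tr}\big[\hat\rho_\omega(t)\hat f_i^\dagger\hat f_j\big].$$ Define the approximated surface roughness $w_{\rm app}(M,t)\ge 0$ by $$w_{\rm app}(M,t)^2=\sum_{\omega}p_M(\omega)\Big(\sum_{j=1}^{M/2}D^\omega_{jj}(t)-\sum_{i,j=1}^{M/2}D^\omega_{ij}(t)D^\omega_{ji}(t)\Big)$$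 and the half-chain von Neumann entanglement entropy by $$S_{\rm EE}(M,t)=-\sum_\omega p_M(\omega)\,\mathrm{Tr}\big[\hat\rho^{A}_\omega(t)\log\hat\rho^{A}_\omega(t)\big],$$ where $\hat\rho^A_\omega(t)$ is the reduced density matrix of the sites $1,\dots,M/2$, that is, the partial trace of $\hat\rho_\omega(t)$ over the sites $M/2+1,\dots,M$. Let $\beta>0$, $a,b>0$ and $0<u_1<u_2$. Assume that for every $\epsilon>0$ there is an integer $M_0$ such that $$\left|\frac{\log w_{\rm app}(M,t)}{\log t}-\beta\right|<\epsilon$$ for all even $M>M_0$ and all $t$ with $aM^{u_1}<t<bM^{u_2}$. Then for every $\delta>0$ there is an integer $M_1$ such that $$\left|\frac{\log S_{\rm EE}(M,t)}{\log t}-2\beta\right|<\delta$$ for all even $M>M_1$ and all $t$ with $aM^{u_1}<t<bM^{u_2}$. -/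

import Mathlib

open scoped Matrix

noncomputable section

namespace FreeFermion

/-- Operators on the fermionic Fock space of `M` lattice sites, as matrices in the occupation-number
basis.  The basis vector labelled by `s : Finset (Fin M)` is the product of the creation operators
of the sites of `s`, in increasing order of the sites from left to right, applied to the vacuum.
Sites are numbered from `0`. -/
abbrev FockOp (M : ℕ) := Matrix (Finset (Fin M)) (Finset (Fin M)) ℂ

/-- The vacuum vector. -/
def vacuum (M : ℕ) : Finset (Fin M) → ℂ := Pi.single ∅ 1

/-- The creation operator of site `j`, with the fermionic sign that counts the occupied sites
before `j`. -/
def create {M : ℕ} (j : Fin M) : FockOp M :=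
  Matrix.of fun s s' =>
    if j ∉ s' ∧ s = insert j s' then (-1 : ℂ) ^ (s'.filter (fun i => i < j)).card else 0

/-- The annihilation operator of site `j`: the adjoint of the creation operator. -/
def annihilate {M : ℕ} (j : Fin M) : FockOp M := (create j)ᴴ

/-- The quadratic many-body Hamiltonian `∑ i j, f_i† H_ij f_j`. -/
def hamiltonian {M : ℕ} (H : Matrix (Fin M) (Fin M) ℂ) : FockOp M :=
  ∑ i, ∑ j, H i j • (create i * annihilate j)

/-- The fermionic Gaussian state `∏ α, (∑ j, f_j† G_jα) |0⟩` (the factors in increasing order of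
`α` from left to right). -/
def gaussianState {M N : ℕ} (G : Matrix (Fin M) (Fin N) ℂ) : Finset (Fin M) → ℂ :=
  (List.ofFn fun α : Fin N => ∑ j, G j α • create j).prod *ᵥ vacuum M

/-- The time-evolved state `exp (- i Ĥ t / ħ) |ψ(0)⟩` of a Gaussian initial state. -/
def state {M N : ℕ} (ħ : ℝ) (H : Matrix (Fin M) (Fin M) ℂ) (G : Matrix (Fin M) (Fin N) ℂ) (t : ℝ) :
    Finset (Fin M) → ℂ :=
  NormedSpace.exp (-(Complex.I * ((t / ħ : ℝ) : ℂ)) • hamiltonian H) *ᵥ gaussianState G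

/-- The density matrix `|ψ⟩⟨ψ|` of a state vector. -/
def density {M : ℕ} (ψ : Finset (Fin M) → ℂ) : FockOp M := Matrix.vecMulVec ψ (star ψ)

/-- The correlation matrix `D_ij = Tr[ρ f_i† f_j]`. -/
def correlation {M : ℕ} (ρ : FockOp M) : Matrix (Fin M) (Fin M) ℂ :=
  Matrix.of fun i j => (ρ * (create i * annihilate j)).trace

/-- The inclusion of the left half of the chain (its first `M / 2` sites) into the chain. -/
def leftHalf (M : ℕ) : Fin (M / 2) ↪ Fin M := Fin.castLEEmb (Nat.div_le_self M 2)

/-- The right half of the chain: the sites outside the left half. -/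
def rightHalf (M : ℕ) : Finset (Fin M) := Finset.univ.filter fun j => M / 2 ≤ (j : ℕ)

/-- The squared approximated surface roughness of a single realization,
`∑_j D_jj - ∑_ij D_ij D_ji`, with `i` and `j` running over the left half of the chain. -/
def roughnessSq {M : ℕ} (ρ : FockOp M) : ℝ :=
  (∑ j, correlation ρ (leftHalf M j) (leftHalf M j)
    - ∑ i, ∑ j, correlation ρ (leftHalf M i) (leftHalf M j)
        * correlation ρ (leftHalf M j) (leftHalf M i)).re

/-- The reduced density matrix of the left half: the partial trace over the right half.  Since the
left half comes first in the ordering of the sites, no sign occurs in the occupation basis. -/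
def reducedDensity {M : ℕ} (ρ : FockOp M) : FockOp (M / 2) :=
  Matrix.of fun s s' => ∑ b ∈ (rightHalf M).powerset,
    ρ (s.map (leftHalf M) ∪ b) (s'.map (leftHalf M) ∪ b)

/-- The von Neumann entropy `- Tr[ρ log ρ]`; the logarithm is taken in the functional calculus of
Hermitian matrices, and `0 log 0 = 0`. -/
def vonNeumannEntropy {M : ℕ} (ρ : FockOp M) : ℝ := -(ρ * cfc Real.log ρ).trace.re

/-- The approximated surface roughness at time `t`, its square being averaged over a finite ensemble
of realizations of the single-particle Hamiltonian, with weights `p`. -/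
def wApp {M N : ℕ} {Ω : Type*} [Fintype Ω] (p : Ω → ℝ) (ħ : ℝ)
    (H : Ω → Matrix (Fin M) (Fin M) ℂ) (G : Matrix (Fin M) (Fin N) ℂ) (t : ℝ) : ℝ :=
  Real.sqrt (∑ ω, p ω * roughnessSq (density (state ħ (H ω) G t)))

/-- The half-chain von Neumann entanglement entropy at time `t`, averaged over a finite ensemble of
realizations of the single-particle Hamiltonian, with weights `p`. -/
def entanglementEntropy {M N : ℕ} {Ω : Type*} [Fintype Ω] (p : Ω → ℝ) (ħ : ℝ)
    (H : Ω → Matrix (Fin M) (Fin M) ℂ) (G : Matrix (Fin M) (Fin N) ℂ) (t : ℝ) : ℝ :=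
  ∑ ω, p ω * vonNeumannEntropy (reducedDensity (density (state ħ (H ω) G t)))

end FreeFermion

end

noncomputable section

namespace FreeFermion

variable {M : ℕ}

/-! Free evolution acts on single-particle orbitals, so at every time the state is a Slater
determinant of orthonormal orbitals (`state_eq_gaussianState`). A unitary change of the orbitals
alters this state only by a phase, so they may be chosen with orthogonal left halves, and then the
right halves are orthogonal too. If `l α` is the weight of orbital `α` on the left, each orbital is
an independent choice of left or right. The squared roughness is then `∑ l (1 - l)` and the entropy
is the sum of the binary entropies of the `l α` (`exists_entanglement_spectrum`).

The elementary bounds `x (1 - x) ≤ h(x) ≤ 2 (log K + 1) x (1 - x) + 1 / K`, taken with `K = M` and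
at most `M` orbitals, give `R ≤ S ≤ 2 (log M + 1) R + 1`. These bounds are linear in `R` and `S`,
hence survive disorder averaging (`entanglementEntropy_bounds`). In the time window `log t` grows at
least like `u₁ log M`, so the factor `log M` costs only `log log M`, negligible against `log t`.
Thus `log S` and `log R = 2 log w` have the same slope in `log t`. -/

/-! ### Canonical anticommutation relations on Fock space. -/

/-- The creation operator of the single-particle state `v`. -/
def createVec (v : Fin M → ℂ) : FockOp M := ∑ j, v j • create j

lemma create_mulVec (j : Fin M) (ψ : Finset (Fin M) → ℂ) (s : Finset (Fin M)) :
    (create j *ᵥ ψ) s =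
      if j ∈ s then (-1 : ℂ) ^ (s.filter (· < j)).card * ψ (s.erase j) else 0 := by
  simp only [create, Matrix.mulVec, dotProduct, Matrix.of_apply]
  split_ifs with h
  · rw [Finset.sum_eq_single (s.erase j)]
    · rw [if_pos ⟨Finset.notMem_erase j s, (Finset.insert_erase h).symm⟩]
      congr 3
      ext i
      simp only [Finset.mem_filter, Finset.mem_erase]
      grind
    · intro s' _ hs'
      rw [if_neg, zero_mul]
      rintro ⟨h1, rfl⟩
      exact hs' (Finset.erase_insert h1).symm
    · simp
  · refine Finset.sum_eq_zero fun s' _ => ?_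
    rw [if_neg, zero_mul]
    rintro ⟨_, rfl⟩
    exact h (Finset.mem_insert_self j s')

lemma annihilate_mulVec (j : Fin M) (ψ : Finset (Fin M) → ℂ) (s : Finset (Fin M)) :
    (annihilate j *ᵥ ψ) s =
      if j ∈ s then 0 else (-1 : ℂ) ^ (s.filter (· < j)).card * ψ (insert j s) := by
  simp only [annihilate, create, Matrix.mulVec, dotProduct, Matrix.conjTranspose_apply,
    Matrix.of_apply]
  split_ifs with h
  · simp [h]
  · rw [Finset.sum_eq_single (insert j s)]
    · simp [h]
    · intro s' _ hs'
      simp [hs']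
    · simp

lemma neg_one_pow_card_filter_erase {s : Finset (Fin M)} {i j : Fin M} (hj : j ∈ s) :
    (-1 : ℂ) ^ ((s.erase j).filter (· < i)).card =
      (if j < i then -1 else 1) * (-1 : ℂ) ^ (s.filter (· < i)).card := by
  rw [Finset.filter_erase]
  split_ifs with h
  · have hm : j ∈ s.filter (· < i) := by simp [hj, h]
    rw [← Finset.card_erase_add_one hm, pow_succ]
    ring
  · rw [Finset.erase_eq_of_notMem (by simp [h]), one_mul]

lemma neg_one_pow_card_filter_insert {s : Finset (Fin M)} {i j : Fin M} (hj : j ∉ s) :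
    (-1 : ℂ) ^ ((insert j s).filter (· < i)).card =
      (if j < i then -1 else 1) * (-1 : ℂ) ^ (s.filter (· < i)).card := by
  rw [Finset.filter_insert]
  split_ifs with h
  · rw [Finset.card_insert_of_notMem (by simp [hj]), pow_succ]
    ring
  · rw [one_mul]

lemma neg_one_pow_mul_self (n : ℕ) : (-1 : ℂ) ^ n * (-1) ^ n = 1 := by
  rw [← pow_add, ← two_mul, pow_mul]
  simp

lemma ext_mulVec {A B : FockOp M} (h : ∀ ψ s, (A *ᵥ ψ) s = (B *ᵥ ψ) s) : A = B :=
  Matrix.mulVec_injective (funext fun ψ => funext (h ψ))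

/-- Creation operators anticommute. -/
lemma create_mul_create_add (i j : Fin M) : create i * create j + create j * create i = 0 := by
  refine ext_mulVec fun ψ s => ?_
  simp only [Matrix.add_mulVec, ← Matrix.mulVec_mulVec, Pi.add_apply, create_mulVec,
    Matrix.zero_mulVec, Pi.zero_apply, Finset.mem_erase]
  rcases eq_or_ne i j with rfl | hij
  · simp
  by_cases hi : i ∈ s <;> by_cases hj : j ∈ s <;> simp only [hi, hj, hij, hij.symm, ne_eq,
    not_false_eq_true, and_true, and_false, if_true, if_false, mul_zero, add_zero]
  rw [neg_one_pow_card_filter_erase hi, neg_one_pow_card_filter_erase hj, Finset.erase_right_comm]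
  rcases lt_or_gt_of_ne hij with h | h <;> simp only [h, h.not_gt, if_true, if_false] <;> ring

/-- The canonical anticommutation relation of annihilation and creation operators. -/
lemma annihilate_mul_create_add (i j : Fin M) :
    annihilate i * create j + create j * annihilate i = if i = j then 1 else 0 := by
  refine ext_mulVec fun ψ s => ?_
  simp only [Matrix.add_mulVec, ← Matrix.mulVec_mulVec, Pi.add_apply, create_mulVec,
    annihilate_mulVec, Finset.mem_insert, Finset.mem_erase]
  rcases eq_or_ne i j with rfl | hij
  · by_cases hi : i ∈ s
    · simp only [hi, if_true, if_false, Finset.insert_erase, ne_eq,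
        not_true_eq_false, false_and, Matrix.one_mulVec, zero_add]
      rw [neg_one_pow_card_filter_erase hi, ← mul_assoc]
      simp [neg_one_pow_mul_self]
    · simp only [hi, if_true, if_false, or_false, Finset.erase_insert, not_false_eq_true,
        Matrix.one_mulVec, add_zero]
      rw [neg_one_pow_card_filter_insert hi, ← mul_assoc]
      simp [neg_one_pow_mul_self]
  by_cases hi : i ∈ s <;> by_cases hj : j ∈ s <;> simp only [hi, hj, hij, hij.symm, ne_eq,
    not_false_eq_true, and_true, and_false, if_true, if_false, mul_zero, add_zero, or_false,
    or_true, Matrix.zero_mulVec, Pi.zero_apply]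
  rw [neg_one_pow_card_filter_insert hi, neg_one_pow_card_filter_erase hj,
    Finset.erase_insert_of_ne hij]
  rcases lt_or_gt_of_ne hij with h | h <;> simp only [h, h.not_gt, if_true, if_false] <;> ring

lemma createVec_add (v w : Fin M → ℂ) : createVec (v + w) = createVec v + createVec w := by
  simp [createVec, add_smul, Finset.sum_add_distrib]

lemma createVec_smul (c : ℂ) (v : Fin M → ℂ) : createVec (c • v) = c • createVec v := by
  simp [createVec, Finset.smul_sum, smul_smul]

lemma createVec_single (j : Fin M) : createVec (Pi.single j 1) = create j := by
  simp [createVec, Pi.single_apply]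

lemma conjTranspose_createVec (v : Fin M → ℂ) :
    (createVec v)ᴴ = ∑ j, star (v j) • annihilate j := by
  simp [createVec, Matrix.conjTranspose_sum, annihilate]

/-- `createVec` as a linear map. -/
def createLin (M : ℕ) : (Fin M → ℂ) →ₗ[ℂ] FockOp M where
  toFun := createVec
  map_add' := createVec_add
  map_smul' := createVec_smul

lemma createVec_mul_add (v w : Fin M → ℂ) :
    createVec v * createVec w + createVec w * createVec v = 0 := by
  simp only [createVec, Finset.sum_mul_sum]
  rw [Finset.sum_comm (f := fun i j => (w i • create i) * (v j • create j)),
    ← Finset.sum_add_distrib]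
  refine Finset.sum_eq_zero fun i _ => ?_
  rw [← Finset.sum_add_distrib]
  refine Finset.sum_eq_zero fun j _ => ?_
  rw [smul_mul_smul_comm, smul_mul_smul_comm, mul_comm (w j), ← smul_add, create_mul_create_add,
    smul_zero]

lemma createVec_mul_self (v : Fin M → ℂ) : createVec v * createVec v = 0 := by
  have h := createVec_mul_add v v
  rw [← two_smul ℂ] at h
  exact (smul_eq_zero.1 h).resolve_left two_ne_zero

lemma conjTranspose_createVec_mul_add (v w : Fin M → ℂ) :
    (createVec v)ᴴ * createVec w + createVec w * (createVec v)ᴴ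
      = (star v ⬝ᵥ w) • (1 : FockOp M) := by
  rw [conjTranspose_createVec]
  simp only [createVec, Finset.sum_mul_sum]
  rw [Finset.sum_comm (f := fun i j => (w i • create i) * (star (v j) • annihilate j)),
    ← Finset.sum_add_distrib]
  simp only [dotProduct, Finset.sum_smul]
  refine Finset.sum_congr rfl fun i _ => ?_
  rw [← Finset.sum_add_distrib]
  have : ∀ j, (star (v i) • annihilate i) * (w j • create j)
      + (w j • create j) * (star (v i) • annihilate i)
      = (star (v i) * w j) • if i = j then (1 : FockOp M) else 0 := by
    intro j
    rw [smul_mul_smul_comm, smul_mul_smul_comm, mul_comm (w j), ← smul_add,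
      annihilate_mul_create_add]
  rw [Finset.sum_congr rfl fun j _ => this j]
  simp

lemma conjTranspose_createVec_mulVec_vacuum (v : Fin M → ℂ) :
    (createVec v)ᴴ *ᵥ vacuum M = 0 := by
  rw [conjTranspose_createVec, Matrix.sum_mulVec]
  refine Finset.sum_eq_zero fun j _ => ?_
  rw [Matrix.smul_mulVec]
  ext s
  simp only [Pi.smul_apply, annihilate_mulVec, vacuum]
  simp

lemma hamiltonian_mulVec_vacuum (H : Matrix (Fin M) (Fin M) ℂ) :
    hamiltonian H *ᵥ vacuum M = 0 := by
  simp only [hamiltonian, Matrix.sum_mulVec, Matrix.smul_mulVec, ← Matrix.mulVec_mulVec]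
  refine Finset.sum_eq_zero fun i _ => Finset.sum_eq_zero fun j _ => ?_
  have h := conjTranspose_createVec_mulVec_vacuum (Pi.single j 1)
  rw [createVec_single] at h
  rw [annihilate, h]
  simp

/-- Carrying `create k` through `create i * annihilate j` changes the sign twice; the only
contraction is that of `annihilate j` with `create k`. -/
lemma hamiltonian_mul_createVec (H : Matrix (Fin M) (Fin M) ℂ) (v : Fin M → ℂ) :
    hamiltonian H * createVec v = createVec v * hamiltonian H + createVec (H *ᵥ v) := by
  have key : ∀ i j k : Fin M, create i * annihilate j * create k
      = create k * (create i * annihilate j) + if j = k then create i else 0 := by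
    intro i j k
    have h1 := annihilate_mul_create_add j k
    have h2 := create_mul_create_add i k
    rw [mul_assoc, eq_sub_of_add_eq h1, mul_sub, ← mul_assoc, ← mul_assoc,
      eq_neg_of_add_eq_zero_left h2]
    split_ifs <;> simp [add_comm]
  have hk : ∀ k, hamiltonian H * create k
      = create k * hamiltonian H + ∑ i, H i k • create i := by
    intro k
    simp only [hamiltonian, Finset.sum_mul, Finset.mul_sum, smul_mul_assoc, mul_smul_comm, key,
      smul_add, Finset.sum_add_distrib]
    congr 1
    refine Finset.sum_congr rfl fun i _ => ?_
    simp
  simp only [createVec, Finset.mul_sum, mul_smul_comm, hk, smul_add, Finset.sum_add_distrib,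
    Finset.sum_mul, smul_mul_assoc]
  congr 1
  simp only [Finset.smul_sum, Matrix.mulVec, dotProduct, Finset.sum_smul, smul_smul]
  rw [Finset.sum_comm]
  simp only [mul_comm]

/-! ### Free time evolution. -/

section Evolution

/-- Conjugation by an exponential, integrated from its infinitesimal form. -/
lemma exp_mul_map_one {A B : Type*} [NormedRing A] [NormedAlgebra ℝ A] [CompleteSpace A]
    [NormedRing B] [NormedAlgebra ℝ B] [CompleteSpace B] (L : B →L[ℝ] A) {X : A} {Y : B}
    (h : ∀ b, X * L b = L b * X + L (Y * b)) :
    NormedSpace.exp X * L 1 = L (NormedSpace.exp Y) * NormedSpace.exp X := by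
  -- In the interaction picture the conjugated quantity is constant: the hypothesis cancels its
  -- derivative. Comparing `t = 1` with `t = 0` gives the claim.
  have hd : ∀ t : ℝ, HasDerivAt (fun t : ℝ => NormedSpace.exp (t • (-X))
      * L (NormedSpace.exp (t • Y)) * NormedSpace.exp (t • X)) 0 t := by
    intro t
    have h1 := hasDerivAt_exp_smul_const (𝕂 := ℝ) (-X) t
    have h2 := L.hasFDerivAt.comp_hasDerivAt t (hasDerivAt_exp_smul_const' (𝕂 := ℝ) Y t)
    have h3 := hasDerivAt_exp_smul_const' (𝕂 := ℝ) X t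
    refine ((h1.mul h2).mul h3).congr_deriv ?_
    simp only [Function.comp_apply, Pi.mul_apply]
    have h4 := h (NormedSpace.exp (t • Y))
    rw [← sub_eq_iff_eq_add'] at h4
    rw [← h4]
    noncomm_ring
  have hc := is_const_of_deriv_eq_zero (fun t => (hd t).differentiableAt) (fun t => (hd t).deriv)
    1 0
  simp only [one_smul, zero_smul, NormedSpace.exp_zero, one_mul, mul_one] at hc
  have hX : NormedSpace.exp X * NormedSpace.exp (-X) = 1 := by
    let := NormedAlgebra.restrictScalars ℚ ℝ A
    have := NormedSpace.exp_add_of_commute (Commute.refl X).neg_right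
    rw [← this, add_neg_cancel, NormedSpace.exp_zero]
  rw [← hc, ← mul_assoc, ← mul_assoc, hX, one_mul]

lemma map_exp_eq_map_one {A E : Type*} [NormedRing A] [NormedAlgebra ℝ A] [CompleteSpace A]
    [NormedAddCommGroup E] [NormedSpace ℝ E] (L : A →L[ℝ] E) {X : A} (h : ∀ a, L (a * X) = 0) :
    L (NormedSpace.exp X) = L 1 := by
  have hd : ∀ t : ℝ, HasDerivAt (fun t : ℝ => L (NormedSpace.exp (t • X))) 0 t := by
    intro t
    exact (L.hasFDerivAt.comp_hasDerivAt t
      (hasDerivAt_exp_smul_const (𝕂 := ℝ) X t)).congr_deriv (h _)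
  have hc := is_const_of_deriv_eq_zero (fun t => (hd t).differentiableAt) (fun t => (hd t).deriv)
    1 0
  simpa using hc

open scoped Matrix.Norms.Operator

/-- Conjugation by the exponential of an operator whose commutator with the creation operators is
implemented by a single-particle matrix. -/
lemma exp_mul_createVec {X : FockOp M} {Y : Matrix (Fin M) (Fin M) ℂ}
    (h : ∀ v, X * createVec v = createVec v * X + createVec (Y *ᵥ v)) (v : Fin M → ℂ) :
    NormedSpace.exp X * createVec v = createVec (NormedSpace.exp Y *ᵥ v) * NormedSpace.exp X := by
  -- With `v` fixed, this map turns left multiplication by `Y` into the commutator with `X`.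
  let L : Matrix (Fin M) (Fin M) ℂ →ₗ[ℝ] FockOp M :=
    { toFun := fun A => createVec (A *ᵥ v)
      map_add' := fun A B => by rw [Matrix.add_mulVec, createVec_add]
      map_smul' := fun c A => by
        rw [Matrix.smul_mulVec]
        exact ((createLin M).restrictScalars ℝ).map_smul c _ }
  have hL : ∀ A, X * L A = L A * X + L (Y * A) := fun A => by
    have := h (A *ᵥ v)
    rwa [Matrix.mulVec_mulVec] at this
  have h1 := exp_mul_map_one (X := X) (Y := Y) L.toContinuousLinearMap hL
  have h2 : L.toContinuousLinearMap (1 : Matrix (Fin M) (Fin M) ℂ) = createVec v :=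
    congrArg createVec (Matrix.one_mulVec v)
  exact (congrArg (NormedSpace.exp X * ·) h2).symm.trans h1

lemma exp_mulVec_eq_self {X : FockOp M} {ψ : Finset (Fin M) → ℂ} (h : X *ᵥ ψ = 0) :
    NormedSpace.exp X *ᵥ ψ = ψ := by
  let L : FockOp M →ₗ[ℝ] (Finset (Fin M) → ℂ) :=
    { toFun := fun A => A *ᵥ ψ
      map_add' := fun A B => Matrix.add_mulVec _ _ _
      map_smul' := fun c A => Matrix.smul_mulVec _ _ _ }
  have h1 := map_exp_eq_map_one (X := X) L.toContinuousLinearMap fun A => by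
    change (A * X) *ᵥ ψ = 0
    rw [← Matrix.mulVec_mulVec, h, Matrix.mulVec_zero]
  exact h1.trans (Matrix.one_mulVec ψ)

lemma exp_mul_prod_createVec {X : FockOp M} {Y : Matrix (Fin M) (Fin M) ℂ}
    (h : ∀ v, X * createVec v = createVec v * X + createVec (Y *ᵥ v)) (l : List (Fin M → ℂ)) :
    NormedSpace.exp X * (l.map createVec).prod
      = (l.map fun v => createVec (NormedSpace.exp Y *ᵥ v)).prod * NormedSpace.exp X := by
  induction l with
  | nil => simp
  | cons v l ih =>
    rw [List.map_cons, List.prod_cons, ← mul_assoc, exp_mul_createVec h, mul_assoc, ih,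
      List.map_cons, List.prod_cons, mul_assoc]

lemma exp_neg_I_smul_isometry (c : ℝ) {H : Matrix (Fin M) (Fin M) ℂ} (hH : H.IsHermitian) :
    (NormedSpace.exp (-(Complex.I * (c : ℂ)) • H))ᴴ * NormedSpace.exp (-(Complex.I * (c : ℂ)) • H)
      = 1 := by
  rw [← Matrix.exp_conjTranspose, Matrix.conjTranspose_smul, hH.eq]
  have : star (-(Complex.I * (c : ℂ))) = -(-(Complex.I * (c : ℂ))) := by simp
  rw [this, neg_smul (-(Complex.I * (c : ℂ))),
    ← Matrix.exp_add_of_commute _ _ (Commute.refl (-(Complex.I * (c : ℂ)) • H)).neg_left,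
    neg_add_cancel, NormedSpace.exp_zero]

end Evolution

/-! ### Slater determinants. -/

/-- The product of the creation operators of a family of single-particle states, applied to the
vacuum. -/
def slater {N : ℕ} (v : Fin N → Fin M → ℂ) : Finset (Fin M) → ℂ :=
  (List.ofFn fun α => createVec (v α)).prod *ᵥ vacuum M

lemma gaussianState_eq_slater {N : ℕ} (G : Matrix (Fin M) (Fin N) ℂ) :
    gaussianState G = slater G.col := rfl

lemma slater_zero (v : Fin 0 → Fin M → ℂ) : slater v = vacuum M := by simp [slater]

lemma slater_succ {N : ℕ} (v : Fin (N + 1) → Fin M → ℂ) :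
    slater v = createVec (v 0) *ᵥ slater (fun α => v α.succ) := by
  simp only [slater, List.ofFn_succ, List.prod_cons, Matrix.mulVec_mulVec]

/-- Free evolution maps a Gaussian state to the Gaussian state of the evolved orbitals. -/
lemma state_eq_gaussianState {N : ℕ} (ħ : ℝ) (H : Matrix (Fin M) (Fin M) ℂ)
    (G : Matrix (Fin M) (Fin N) ℂ) (t : ℝ) :
    state ħ H G t
      = gaussianState (NormedSpace.exp (-(Complex.I * ((t / ħ : ℝ) : ℂ)) • H) * G) := by
  have hcomm : ∀ v, (-(Complex.I * ((t / ħ : ℝ) : ℂ)) • hamiltonian H) * createVec v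
      = createVec v * (-(Complex.I * ((t / ħ : ℝ) : ℂ)) • hamiltonian H)
        + createVec ((-(Complex.I * ((t / ħ : ℝ) : ℂ)) • H) *ᵥ v) := by
    intro v
    rw [smul_mul_assoc, hamiltonian_mul_createVec, smul_add, mul_smul_comm, Matrix.smul_mulVec,
      createVec_smul]
  have hvac : (-(Complex.I * ((t / ħ : ℝ) : ℂ)) • hamiltonian H) *ᵥ vacuum M = 0 := by
    rw [Matrix.smul_mulVec, hamiltonian_mulVec_vacuum, smul_zero]
  rw [state, gaussianState_eq_slater, gaussianState_eq_slater]
  simp only [slater, Matrix.mulVec_mulVec]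
  have h := exp_mul_prod_createVec hcomm (List.ofFn G.col)
  rw [List.map_ofFn, List.map_ofFn] at h
  simp only [Function.comp_def] at h
  rw [h, ← Matrix.mulVec_mulVec, exp_mulVec_eq_self hvac]
  rfl

/-- The Slater determinant as an alternating map of its orbitals. -/
def slaterAlternating (M N : ℕ) : (Fin M → ℂ) [⋀^Fin N]→ₗ[ℂ] (Finset (Fin M) → ℂ) :=
  ((Matrix.mulVecBilin ℂ ℂ).flip (vacuum M) ∘ₗ
    (ExteriorAlgebra.lift ℂ ⟨createLin M, createVec_mul_self⟩).toLinearMap).compAlternatingMap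
    (ExteriorAlgebra.ιMulti ℂ N)

lemma slaterAlternating_apply {N : ℕ} (v : Fin N → Fin M → ℂ) :
    slaterAlternating M N v = slater v := by
  simp [slaterAlternating, ExteriorAlgebra.ιMulti_apply, map_list_prod, List.map_ofFn,
    Function.comp_def, slater, createLin]

/-- Each coefficient is an alternating form in `N` vectors of an `N`-dimensional space, hence a
multiple of the determinant. -/
lemma slater_mulVec {N : ℕ} (G : Matrix (Fin M) (Fin N) ℂ) (w : Fin N → Fin N → ℂ) :
    slater (fun α => G *ᵥ w α) = (Matrix.of w).det • slater G.col := by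
  ext s
  have h := ((LinearMap.proj s).compAlternatingMap
    ((slaterAlternating M N).compLinearMap G.mulVecLin)).eq_smul_basis_det (Pi.basisFun ℂ (Fin N))
  have h2 := congrArg (fun f => f w) h
  simp only [LinearMap.compAlternatingMap_apply, AlternatingMap.compLinearMap_apply,
    slaterAlternating_apply, LinearMap.proj_apply, AlternatingMap.smul_apply, Pi.basisFun_det_apply,
    Pi.basisFun_apply, Matrix.mulVecLin_apply, smul_eq_mul, Matrix.mulVec_single_one] at h2
  rw [h2, mul_comm]
  rfl

lemma gaussianState_mul {N : ℕ} (G : Matrix (Fin M) (Fin N) ℂ) (W : Matrix (Fin N) (Fin N) ℂ) :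
    gaussianState (G * W) = W.det • gaussianState G := by
  rw [← Matrix.det_transpose W]
  exact slater_mulVec G Wᵀ

/-- The determinant of `W` is a phase, which cancels between ket and bra. -/
lemma density_gaussianState_mul {N : ℕ} (G : Matrix (Fin M) (Fin N) ℂ)
    {W : Matrix (Fin N) (Fin N) ℂ} (hW : Wᴴ * W = 1) :
    density (gaussianState (G * W)) = density (gaussianState G) := by
  have hd : W.det * star W.det = 1 := by
    have := congrArg Matrix.det hW
    rwa [Matrix.det_mul, Matrix.det_conjTranspose, Matrix.det_one, mul_comm] at this
  ext s s'
  rw [gaussianState_mul]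
  simp only [density, Matrix.vecMulVec_apply, Pi.smul_apply, Pi.star_apply, smul_eq_mul, star_mul']
  linear_combination (gaussianState G s * star (gaussianState G s')) * hd

/-- Pauli exclusion: the enlarged Slater determinant has a repeated orbital. -/
lemma createVec_mulVec_slater {N : ℕ} (v : Fin N → Fin M → ℂ) (α : Fin N) :
    createVec (v α) *ᵥ slater v = 0 := by
  have := slater_succ (Fin.cons (v α) v : Fin (N + 1) → Fin M → ℂ)
  simp only [Fin.cons_zero, Fin.cons_succ] at this
  rw [← this, ← slaterAlternating_apply]
  exact AlternatingMap.map_eq_zero_of_eq _ _ (i := 0) (j := α.succ) (by simp)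
    (Fin.succ_ne_zero α).symm

/-- The annihilator of `w` anticommutes with every factor and so reaches the vacuum, which it kills.
-/
lemma conjTranspose_createVec_mulVec_slater {N : ℕ} (v : Fin N → Fin M → ℂ) {w : Fin M → ℂ}
    (hw : ∀ α, star w ⬝ᵥ v α = 0) : (createVec w)ᴴ *ᵥ slater v = 0 := by
  induction N with
  | zero => rw [slater_zero, conjTranspose_createVec_mulVec_vacuum]
  | succ N ih =>
    rw [slater_succ, Matrix.mulVec_mulVec, eq_sub_of_add_eq (conjTranspose_createVec_mul_add _ _),
      hw, zero_smul, zero_sub, Matrix.neg_mulVec, ← Matrix.mulVec_mulVec,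
      ih _ fun α => hw α.succ, Matrix.mulVec_zero, neg_zero]

lemma star_mulVec_dotProduct_mulVec {n m : Type*} [Fintype n] [Fintype m] (A : Matrix n m ℂ)
    (x : m → ℂ) (y : n → ℂ) : star (A *ᵥ x) ⬝ᵥ y = star x ⬝ᵥ (Aᴴ *ᵥ y) := by
  rw [Matrix.star_mulVec, Matrix.dotProduct_mulVec]

lemma star_createVec_mulVec_dotProduct {v w : Fin M → ℂ} {x y : Finset (Fin M) → ℂ}
    (h : (createVec v)ᴴ *ᵥ y = 0) :
    star (createVec v *ᵥ x) ⬝ᵥ (createVec w *ᵥ y) = (star v ⬝ᵥ w) * (star x ⬝ᵥ y) := by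
  rw [star_mulVec_dotProduct_mulVec, Matrix.mulVec_mulVec,
    eq_sub_of_add_eq (conjTranspose_createVec_mul_add _ _), Matrix.sub_mulVec,
    ← Matrix.mulVec_mulVec, h, Matrix.mulVec_zero, sub_zero, Matrix.smul_mulVec,
    Matrix.one_mulVec, dotProduct_smul, smul_eq_mul]

lemma star_vacuum_dotProduct_vacuum : star (vacuum M) ⬝ᵥ vacuum M = 1 := by
  simp [vacuum]

lemma star_slater_dotProduct_self {N : ℕ} {v : Fin N → Fin M → ℂ}
    (hv : ∀ α β, star (v α) ⬝ᵥ v β = if α = β then 1 else 0) :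
    star (slater v) ⬝ᵥ slater v = 1 := by
  induction N with
  | zero => rw [slater_zero, star_vacuum_dotProduct_vacuum]
  | succ N ih =>
    rw [slater_succ, star_createVec_mulVec_dotProduct, hv, if_pos rfl, one_mul]
    · exact ih fun α β => by rw [hv]; simp
    · exact conjTranspose_createVec_mulVec_slater _ fun α => by
        rw [hv, if_neg (Fin.succ_ne_zero α).symm]

/-! ### Splitting the chain and the Schmidt decomposition. -/

/-- The parity of the number of particles. -/
def parity (M : ℕ) : FockOp M := Matrix.diagonal fun s => (-1 : ℂ) ^ s.card

lemma parity_mulVec (ψ : Finset (Fin M) → ℂ) (s : Finset (Fin M)) :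
    (parity M *ᵥ ψ) s = (-1 : ℂ) ^ s.card * ψ s := by
  simp [parity, Matrix.mulVec_diagonal]

lemma conjTranspose_parity : (parity M)ᴴ = parity M := by
  simp [parity, Matrix.diagonal_conjTranspose, Pi.star_def]

lemma parity_mul_self : parity M * parity M = 1 := by
  simp [parity, Matrix.diagonal_mul_diagonal, neg_one_pow_mul_self]

lemma createVec_mulVec (v : Fin M → ℂ) (ψ : Finset (Fin M) → ℂ) (s : Finset (Fin M)) :
    (createVec v *ᵥ ψ) s
      = ∑ j ∈ s, v j * ((-1 : ℂ) ^ (s.filter (· < j)).card * ψ (s.erase j)) := by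
  simp [createVec, Matrix.sum_mulVec, Matrix.smul_mulVec, create_mulVec, Finset.sum_ite_mem]

lemma parity_mul_createVec (v : Fin M → ℂ) :
    parity M * createVec v = -(createVec v * parity M) := by
  refine ext_mulVec fun ψ s => ?_
  rw [Matrix.neg_mulVec, Pi.neg_apply, ← Matrix.mulVec_mulVec, ← Matrix.mulVec_mulVec,
    parity_mulVec, createVec_mulVec, createVec_mulVec, Finset.mul_sum, ← Finset.sum_neg_distrib]
  refine Finset.sum_congr rfl fun j hj => ?_
  rw [parity_mulVec, ← Finset.card_erase_add_one hj, pow_succ]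
  ring

lemma conjTranspose_createVec_mul_parity (v : Fin M → ℂ) :
    (createVec v)ᴴ * parity M = -(parity M * (createVec v)ᴴ) := by
  have h := congrArg Matrix.conjTranspose (parity_mul_createVec v)
  rwa [Matrix.conjTranspose_mul, conjTranspose_parity, Matrix.conjTranspose_neg,
    Matrix.conjTranspose_mul, conjTranspose_parity] at h

/-- The restriction of a single-particle state to the left half of the chain. -/
def leftPart (v : Fin M → ℂ) : Fin (M / 2) → ℂ := fun j => v (leftHalf M j)

/-- The part of a single-particle state on the right half of the chain. -/
def rightPart (v : Fin M → ℂ) : Fin M → ℂ := fun j => if M / 2 ≤ (j : ℕ) then v j else 0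

lemma disjoint_map_leftHalf {s : Finset (Fin (M / 2))} {b : Finset (Fin M)}
    (hb : b ⊆ rightHalf M) : Disjoint (s.map (leftHalf M)) b := by
  rw [Finset.disjoint_left]
  intro i hi hib
  obtain ⟨j, -, rfl⟩ := Finset.mem_map.1 hi
  have := (Finset.mem_filter.1 (hb hib)).2
  have h2 := j.2
  simp [leftHalf] at this
  omega

/-- A creation operator splits into its parts on the two halves of the chain. -/
lemma createVec_mulVec_union (v : Fin M → ℂ) (ψ : Finset (Fin M) → ℂ) (s : Finset (Fin (M / 2)))
    {b : Finset (Fin M)} (hb : b ⊆ rightHalf M) :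
    (createVec v *ᵥ ψ) (s.map (leftHalf M) ∪ b)
      = (createVec (leftPart v) *ᵥ fun s' => ψ (s'.map (leftHalf M) ∪ b)) s
        + (-1 : ℂ) ^ s.card
          * (createVec (rightPart v) *ᵥ fun b' => ψ (s.map (leftHalf M) ∪ b')) b := by
  have hd := disjoint_map_leftHalf (s := s) hb
  have hb' : ∀ j ∈ b, M / 2 ≤ (j : ℕ) := fun j hj => (Finset.mem_filter.1 (hb hj)).2
  have hs' : ∀ j : Fin (M / 2), ((leftHalf M j : Fin M) : ℕ) = j := fun j => rfl
  simp only [createVec_mulVec]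
  rw [Finset.sum_union hd, Finset.sum_map, Finset.mul_sum]
  congr 1
  · refine Finset.sum_congr rfl fun j hj => ?_
    have h1 : (s.map (leftHalf M) ∪ b).filter (· < leftHalf M j)
        = (s.filter (· < j)).map (leftHalf M) := by
      ext i
      simp only [Finset.mem_filter, Finset.mem_union, Finset.mem_map]
      constructor
      · rintro ⟨⟨k, hk, rfl⟩ | hi, hlt⟩
        · exact ⟨k, ⟨hk, hlt⟩, rfl⟩
        · have := hb' i hi
          have h2 := j.2
          rw [Fin.lt_def, hs'] at hlt
          omega
      · rintro ⟨k, ⟨hk, hlt⟩, rfl⟩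
        exact ⟨Or.inl ⟨k, hk, rfl⟩, hlt⟩
    have h2 : (s.map (leftHalf M) ∪ b).erase (leftHalf M j)
        = (s.erase j).map (leftHalf M) ∪ b := by
      have : leftHalf M j ∉ b :=
        Finset.disjoint_left.1 hd (Finset.mem_map_of_mem _ hj)
      rw [Finset.erase_union_distrib, Finset.erase_eq_of_notMem this, Finset.map_erase]
    rw [h1, h2, Finset.card_map]
    rfl
  · refine Finset.sum_congr rfl fun j hj => ?_
    -- Every site of the left half precedes `j`; this is the origin of the sign `(-1) ^ s.card`.
    have h1 : (s.map (leftHalf M) ∪ b).filter (· < j)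
        = s.map (leftHalf M) ∪ b.filter (· < j) := by
      rw [Finset.filter_union, Finset.filter_true_of_mem]
      intro i hi
      obtain ⟨k, -, rfl⟩ := Finset.mem_map.1 hi
      have := hb' j hj
      have h2 := k.2
      rw [Fin.lt_def, hs']
      omega
    have h2 : (s.map (leftHalf M) ∪ b).erase j = s.map (leftHalf M) ∪ b.erase j := by
      rw [Finset.erase_union_distrib,
        Finset.erase_eq_of_notMem (Finset.disjoint_right.1 hd hj)]
    rw [h1, h2, Finset.card_union_of_disjoint (hd.mono_right (Finset.filter_subset _ _)),
      Finset.card_map, rightPart, if_pos (hb' j hj), pow_add]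
    ring

lemma star_rightPart_dotProduct_add (v w : Fin M → ℂ) :
    star (leftPart v) ⬝ᵥ leftPart w + star (rightPart v) ⬝ᵥ rightPart w = star v ⬝ᵥ w := by
  have h : (Finset.univ.filter fun j : Fin M => ¬ M / 2 ≤ (j : ℕ))
      = (Finset.univ : Finset (Fin (M / 2))).map (leftHalf M) := by
    ext i
    simp only [Finset.mem_filter, Finset.mem_univ, true_and, Finset.mem_map, not_le]
    constructor
    · intro hi
      exact ⟨⟨i, hi⟩, rfl⟩
    · rintro ⟨k, rfl⟩
      exact k.2
  simp only [dotProduct]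
  rw [← Finset.sum_filter_add_sum_filter_not Finset.univ (fun j : Fin M => M / 2 ≤ (j : ℕ))
    (fun j => star v j * w j), h, Finset.sum_map, add_comm, Finset.sum_filter]
  congr 1
  refine Finset.sum_congr rfl fun j _ => ?_
  simp only [rightPart, Pi.star_apply]
  split_ifs <;> simp

/-- A Schmidt decomposition of the Slater determinant of orbitals whose restrictions to the two
halves of the chain are orthogonal, with the entropy of its weights. -/
lemma exists_schmidt {N : ℕ} (v : Fin N → Fin M → ℂ) (l : Fin N → ℝ)
    (hl0 : ∀ α, 0 ≤ l α) (hl1 : ∀ α, l α ≤ 1)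
    (hL : ∀ α β, star (leftPart (v α)) ⬝ᵥ leftPart (v β) = if α = β then (l α : ℂ) else 0)
    (hR : ∀ α β, star (rightPart (v α)) ⬝ᵥ rightPart (v β)
      = if α = β then ((1 - l α : ℝ) : ℂ) else 0) :
    ∃ (ι : Type) (_ : Fintype ι) (_ : DecidableEq ι) (x : ι → Finset (Fin (M / 2)) → ℂ)
      (y : ι → Finset (Fin M) → ℂ) (p q : ι → ℝ),
      (∀ i, 0 ≤ p i) ∧ (∀ i, 0 ≤ q i) ∧ (∑ i, p i * q i = 1) ∧
      (∑ i, Real.negMulLog (p i * q i) = ∑ α, Real.binEntropy (l α)) ∧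
      (∀ i j, star (x i) ⬝ᵥ x j = if i = j then (p i : ℂ) else 0) ∧
      (∀ i j, star (y i) ⬝ᵥ y j = if i = j then (q i : ℂ) else 0) ∧
      (∀ i b, ¬ b ⊆ rightHalf M → y i b = 0) ∧
      (∀ w, (∀ α, star w ⬝ᵥ leftPart (v α) = 0) → ∀ i, (createVec w)ᴴ *ᵥ x i = 0) ∧
      (∀ w, (∀ α, star w ⬝ᵥ rightPart (v α) = 0) → ∀ i, (createVec w)ᴴ *ᵥ y i = 0) ∧
      (∀ s b, b ⊆ rightHalf M →
        slater v (s.map (leftHalf M) ∪ b) = ∑ i, x i s * y i b) := by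
  induction N with
  | zero =>
    refine ⟨Unit, inferInstance, inferInstance, fun _ => vacuum _, fun _ => vacuum _, fun _ => 1,
      fun _ => 1, by simp, by simp, by simp, by simp, ?_, ?_, ?_, ?_, ?_, ?_⟩
    · simp [star_vacuum_dotProduct_vacuum]
    · simp [star_vacuum_dotProduct_vacuum]
    · rintro - b hb
      have : b ≠ ∅ := by rintro rfl; simp at hb
      simp [vacuum, this]
    · exact fun w _ _ => conjTranspose_createVec_mulVec_vacuum w
    · exact fun w _ _ => conjTranspose_createVec_mulVec_vacuum w
    · intro s b _
      rw [slater_zero]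
      simp only [vacuum, Finset.univ_unique, Finset.sum_singleton, Pi.single_apply,
        Finset.union_eq_empty, Finset.map_eq_empty]
      split_ifs <;> simp_all
  | succ N ih =>
    -- The annihilation clauses `hxa` and `hya` are carried through the induction to make the two
    -- branches of the next orbital orthogonal.
    obtain ⟨ι, _, _, x, y, p, q, hp, hq, hpq, hS, hx, hy, hy0, hxa, hya, hψ⟩ :=
      ih (fun α => v α.succ) (fun α => l α.succ) (fun α => hl0 _) (fun α => hl1 _)
        (fun α β => by rw [hL]; simp) (fun α β => by rw [hR]; simp)
    have hx0 : ∀ i, (createVec (leftPart (v 0)))ᴴ *ᵥ x i = 0 := hxa _ fun α => by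
      rw [hL, if_neg (Fin.succ_ne_zero α).symm]
    have hy00 : ∀ i, (createVec (rightPart (v 0)))ᴴ *ᵥ y i = 0 := hya _ fun α => by
      rw [hR, if_neg (Fin.succ_ne_zero α).symm]
    have hpar : ∀ w, ∀ i, (createVec w)ᴴ *ᵥ x i = 0 →
        (createVec w)ᴴ *ᵥ (parity _ *ᵥ x i) = 0 := by
      intro w i h
      rw [Matrix.mulVec_mulVec, conjTranspose_createVec_mul_parity, Matrix.neg_mulVec,
        ← Matrix.mulVec_mulVec, h, Matrix.mulVec_zero, neg_zero]
    have hcre : ∀ {K : ℕ} (w u : Fin K → ℂ) (z : Finset (Fin K) → ℂ), star w ⬝ᵥ u = 0 →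
        (createVec w)ᴴ *ᵥ z = 0 → (createVec w)ᴴ *ᵥ (createVec u *ᵥ z) = 0 := by
      intro K w u z h1 h2
      rw [Matrix.mulVec_mulVec, eq_sub_of_add_eq (conjTranspose_createVec_mul_add _ _), h1,
        zero_smul, zero_sub, Matrix.neg_mulVec, ← Matrix.mulVec_mulVec, h2, Matrix.mulVec_zero,
        neg_zero]
    -- The new orbital is placed on the left (weight `l 0`) or on the right (weight `1 - l 0`),
    -- which doubles the index set. In the second branch the parity on the left factor records the
    -- sign of passing a right creation operator over the left sites.
    refine ⟨ι ⊕ ι, inferInstance, inferInstance,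
      Sum.elim (fun i => createVec (leftPart (v 0)) *ᵥ x i) (fun i => parity _ *ᵥ x i),
      Sum.elim y (fun i => createVec (rightPart (v 0)) *ᵥ y i),
      Sum.elim (fun i => l 0 * p i) p, Sum.elim q (fun i => (1 - l 0) * q i),
      ?_, ?_, ?_, ?_, ?_, ?_, ?_, ?_, ?_, ?_⟩
    · rintro (i | i)
      · exact mul_nonneg (hl0 0) (hp i)
      · exact hp i
    · rintro (i | i)
      · exact hq i
      · exact mul_nonneg (sub_nonneg.2 (hl1 0)) (hq i)
    · simp only [Fintype.sum_sum_type, Sum.elim_inl, Sum.elim_inr, mul_assoc,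
        mul_left_comm (p _), ← Finset.mul_sum, hpq]
      ring
    -- Entropy is additive over independent choices: the product rule of `negMulLog` together with
    -- total weight one.
    · simp only [Fintype.sum_sum_type, Sum.elim_inl, Sum.elim_inr, mul_assoc,
        mul_left_comm (p _) (1 - l 0), Real.negMulLog_mul _ (p _ * q _), Finset.sum_add_distrib,
        ← Finset.mul_sum, hS, Fin.sum_univ_succ]
      simp only [← mul_assoc, ← Finset.sum_mul, hpq]
      rw [Real.binEntropy_eq_negMulLog_add_negMulLog_one_sub]
      ring
    · have hoff : ∀ i j, star (createVec (leftPart (v 0)) *ᵥ x i) ⬝ᵥ (parity _ *ᵥ x j) = 0 := by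
        intro i j
        rw [star_mulVec_dotProduct_mulVec, hpar _ _ (hx0 j), dotProduct_zero]
      rintro (i | i) (j | j)
      · simp only [Sum.elim_inl, Sum.inl.injEq]
        rw [star_createVec_mulVec_dotProduct (hx0 j), hL, if_pos rfl, hx]
        split_ifs <;> simp
      · simp only [Sum.elim_inl, Sum.elim_inr, reduceCtorEq, if_false]
        exact hoff i j
      · simp only [Sum.elim_inl, Sum.elim_inr, reduceCtorEq, if_false]
        rw [Matrix.star_dotProduct, hoff, star_zero]
      · simp only [Sum.elim_inr, Sum.inr.injEq]
        rw [star_mulVec_dotProduct_mulVec, conjTranspose_parity, Matrix.mulVec_mulVec,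
          parity_mul_self, Matrix.one_mulVec, hx]
    · rintro (i | i) (j | j)
      · simp only [Sum.elim_inl, Sum.inl.injEq, hy]
      · simp only [Sum.elim_inl, Sum.elim_inr, reduceCtorEq, if_false]
        rw [Matrix.star_dotProduct, star_mulVec_dotProduct_mulVec, hy00, dotProduct_zero,
          star_zero]
      · simp only [Sum.elim_inl, Sum.elim_inr, reduceCtorEq, if_false]
        rw [star_mulVec_dotProduct_mulVec, hy00, dotProduct_zero]
      · simp only [Sum.elim_inr, Sum.inr.injEq]
        rw [star_createVec_mulVec_dotProduct (hy00 j), hR, if_pos rfl, hy]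
        split_ifs <;> simp
    · rintro (i | i) b hb
      · exact hy0 i b hb
      · simp only [Sum.elim_inr]
        rw [createVec_mulVec]
        refine Finset.sum_eq_zero fun j hj => ?_
        by_cases hj2 : M / 2 ≤ (j : ℕ)
        · rw [hy0 i, mul_zero, mul_zero]
          intro h
          refine hb fun k hk => ?_
          rcases eq_or_ne k j with rfl | hkj
          · simp [rightHalf, hj2]
          · exact h (Finset.mem_erase.2 ⟨hkj, hk⟩)
        · rw [rightPart, if_neg hj2, zero_mul]
    · rintro w hw (i | i)
      · exact hcre _ _ _ (hw 0) (hxa w (fun α => hw α.succ) i)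
      · exact hpar _ _ (hxa w (fun α => hw α.succ) i)
    · rintro w hw (i | i)
      · exact hya w (fun α => hw α.succ) i
      · exact hcre _ _ _ (hw 0) (hya w (fun α => hw α.succ) i)
    · intro s b hb
      rw [slater_succ, createVec_mulVec_union _ _ _ hb]
      simp only [Fintype.sum_sum_type, Sum.elim_inl, Sum.elim_inr]
      congr 1
      · have h : (fun s' : Finset (Fin (M / 2)) =>
            slater (fun α => v α.succ) (s'.map (leftHalf M) ∪ b)) = ∑ i, y i b • x i := by
          ext s'
          rw [hψ _ _ hb]
          simp [mul_comm]
        rw [h, Matrix.mulVec_sum, Finset.sum_apply]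
        refine Finset.sum_congr rfl fun i _ => ?_
        rw [Matrix.mulVec_smul, Pi.smul_apply, smul_eq_mul, mul_comm]
      · simp only [createVec_mulVec, parity_mulVec, Finset.mul_sum]
        rw [Finset.sum_comm]
        refine Finset.sum_congr rfl fun j _ => ?_
        rw [hψ _ _ ((Finset.erase_subset _ _).trans hb), Finset.mul_sum, Finset.mul_sum,
          Finset.mul_sum]
        refine Finset.sum_congr rfl fun i _ => ?_
        ring

/-! ### Entropy from the Schmidt weights. -/

/-- A trace functional of `Q Qᴴ` in terms of the diagonal matrix `Qᴴ Q`. -/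
lemma trace_mul_cfc {n ι : Type*} [Fintype n] [DecidableEq n] [Fintype ι] [DecidableEq ι]
    (Q : Matrix n ι ℂ) (d : ι → ℝ) (h : Qᴴ * Q = Matrix.diagonal fun i => (d i : ℂ)) (f : ℝ → ℝ) :
    (Q * Qᴴ * cfc f (Q * Qᴴ)).trace = ((∑ i, d i * f (d i) : ℝ) : ℂ) := by
  have hsa : IsSelfAdjoint (Q * Qᴴ) := Matrix.isHermitian_mul_conjTranspose_self Q
  have hfin : (spectrum ℝ (Q * Qᴴ)).Finite := Matrix.finite_real_spectrum
  -- Interpolating `f` on the spectrum and on the values of `d` replaces it by a polynomial `P`, and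
  -- polynomials intertwine: `P(Q Qᴴ) Q = Q P(Qᴴ Q)`.
  let S : Finset ℝ := hfin.toFinset ∪ Finset.univ.image d
  let P : Polynomial ℝ := Lagrange.interpolate S id f
  have hP : ∀ x ∈ S, P.eval x = f x := fun x hx =>
    Lagrange.eval_interpolate_at_node f Function.injective_id.injOn hx
  have h1 : cfc f (Q * Qᴴ) = Polynomial.aeval (Q * Qᴴ) P := by
    rw [← cfc_polynomial P (Q * Qᴴ)]
    exact cfc_congr fun x hx => (hP x (by simp [S, hx])).symm
  have hcomm : ∀ R : Polynomial ℝ,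
      Polynomial.aeval (Q * Qᴴ) R * Q = Q * Polynomial.aeval (Qᴴ * Q) R := by
    intro R
    induction R using Polynomial.induction_on' with
    | add p q hp hq => rw [map_add, map_add, Matrix.add_mul, Matrix.mul_add, hp, hq]
    | monomial k c =>
      have hk : ∀ k : ℕ, (Q * Qᴴ) ^ k * Q = Q * (Qᴴ * Q) ^ k := by
        intro k
        induction k with
        | zero => simp
        | succ k ih => rw [pow_succ', pow_succ', Matrix.mul_assoc, ih]; simp only [Matrix.mul_assoc]
      rw [Polynomial.aeval_monomial, Polynomial.aeval_monomial, ← Algebra.smul_def,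
        ← Algebra.smul_def, Matrix.smul_mul, Matrix.mul_smul, hk]
  have hdiag : Polynomial.aeval (Qᴴ * Q) P = Matrix.diagonal fun i => ((f (d i) : ℝ) : ℂ) := by
    rw [h]
    have hpow : ∀ R : Polynomial ℝ, Polynomial.aeval (Matrix.diagonal fun i => (d i : ℂ)) R
        = Matrix.diagonal fun i => ((R.eval (d i) : ℝ) : ℂ) := by
      intro R
      induction R using Polynomial.induction_on' with
      | add p q hp hq => simp [hp, hq, Matrix.diagonal_add]
      | monomial k c =>
        rw [Polynomial.aeval_monomial, ← Algebra.smul_def, Matrix.diagonal_pow]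
        ext i j
        by_cases hij : i = j <;> simp [hij]
    rw [hpow]
    congr 1
    ext i
    rw [hP _ (by simp [S])]
  rw [h1, Matrix.mul_assoc, Matrix.trace_mul_comm, Matrix.mul_assoc, hcomm, hdiag]
  rw [← Matrix.mul_assoc, h, Matrix.diagonal_mul_diagonal, Matrix.trace_diagonal]
  push_cast
  rfl

/-- Orthogonality of the `y i` removes the cross terms of the partial trace. Splitting `q i` into
two square roots gives the form `Q * Qᴴ` that `trace_mul_cfc` needs. -/
lemma reducedDensity_eq {ι : Type*} [Fintype ι] [DecidableEq ι] {ψ : Finset (Fin M) → ℂ}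
    {x : ι → Finset (Fin (M / 2)) → ℂ} {y : ι → Finset (Fin M) → ℂ} {q : ι → ℝ} (hq : ∀ i, 0 ≤ q i)
    (hy : ∀ i j, star (y i) ⬝ᵥ y j = if i = j then (q i : ℂ) else 0)
    (hy0 : ∀ i b, ¬ b ⊆ rightHalf M → y i b = 0)
    (hψ : ∀ s b, b ⊆ rightHalf M → ψ (s.map (leftHalf M) ∪ b) = ∑ i, x i s * y i b) :
    reducedDensity (density ψ) = (Matrix.of fun s i => (Real.sqrt (q i) : ℂ) * x i s)
      * (Matrix.of fun s i => (Real.sqrt (q i) : ℂ) * x i s)ᴴ := by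
  ext s s'
  have hy2 : ∀ i j, ∑ b ∈ (rightHalf M).powerset, y i b * star (y j b)
      = if j = i then (q j : ℂ) else 0 := by
    intro i j
    rw [← hy, dotProduct, ← Finset.sum_subset (Finset.subset_univ (rightHalf M).powerset)]
    · exact Finset.sum_congr rfl fun b _ => mul_comm _ _
    · intro b _ hb
      rw [hy0 i b (by simpa using hb), mul_zero]
  simp only [reducedDensity, density, Matrix.of_apply, Matrix.vecMulVec_apply, Pi.star_apply,
    Matrix.mul_apply, Matrix.conjTranspose_apply]
  calc _ = ∑ b ∈ (rightHalf M).powerset, ∑ i, ∑ j,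
        (x i s * star (x j s')) * (y i b * star (y j b)) := by
        refine Finset.sum_congr rfl fun b hb => ?_
        rw [hψ _ _ (Finset.mem_powerset.1 hb), hψ _ _ (Finset.mem_powerset.1 hb), star_sum,
          Finset.sum_mul_sum]
        refine Finset.sum_congr rfl fun i _ => Finset.sum_congr rfl fun j _ => ?_
        rw [star_mul']
        ring
    _ = ∑ i, x i s * star (x i s') * (q i : ℂ) := by
        rw [Finset.sum_comm]
        refine Finset.sum_congr rfl fun i _ => ?_
        rw [Finset.sum_comm]
        simp only [← Finset.mul_sum, hy2]
        simp
    _ = _ := by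
        refine Finset.sum_congr rfl fun i _ => ?_
        have : (q i : ℂ) = (Real.sqrt (q i) : ℂ) * (Real.sqrt (q i) : ℂ) := by
          rw [← Complex.ofReal_mul, Real.mul_self_sqrt (hq i)]
        rw [this, star_mul']
        simp only [Complex.star_def, Complex.conj_ofReal]
        ring

lemma vonNeumannEntropy_slater {N : ℕ} (v : Fin N → Fin M → ℂ) (l : Fin N → ℝ)
    (hl0 : ∀ α, 0 ≤ l α) (hl1 : ∀ α, l α ≤ 1)
    (hL : ∀ α β, star (leftPart (v α)) ⬝ᵥ leftPart (v β) = if α = β then (l α : ℂ) else 0)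
    (hR : ∀ α β, star (rightPart (v α)) ⬝ᵥ rightPart (v β)
      = if α = β then ((1 - l α : ℝ) : ℂ) else 0) :
    vonNeumannEntropy (reducedDensity (density (slater v))) = ∑ α, Real.binEntropy (l α) := by
  obtain ⟨ι, _, _, x, y, p, q, hp, hq, -, hS, hx, hy, hy0, -, -, hψ⟩ :=
    exists_schmidt v l hl0 hl1 hL hR
  have hQ : (Matrix.of fun s i => (Real.sqrt (q i) : ℂ) * x i s)ᴴ
      * (Matrix.of fun s i => (Real.sqrt (q i) : ℂ) * x i s)
      = Matrix.diagonal fun i => ((p i * q i : ℝ) : ℂ) := by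
    ext i j
    have := hx i j
    simp only [dotProduct, Pi.star_apply] at this
    simp only [Matrix.mul_apply, Matrix.conjTranspose_apply, Matrix.of_apply, star_mul',
      Complex.star_def, Complex.conj_ofReal, Matrix.diagonal_apply]
    have h2 : ∀ s, (Real.sqrt (q i) : ℂ) * (starRingEnd ℂ) (x i s) * ((Real.sqrt (q j) : ℂ) * x j s)
        = ((Real.sqrt (q i) : ℂ) * (Real.sqrt (q j) : ℂ)) * (star (x i s) * x j s) := by
      intro s
      rw [Complex.star_def]
      ring
    simp only [h2, ← Finset.mul_sum, this]
    split_ifs with hij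
    · subst hij
      rw [← Complex.ofReal_mul, Real.mul_self_sqrt (hq i)]
      push_cast
      ring
    · simp
  rw [vonNeumannEntropy, reducedDensity_eq hq hy hy0 hψ, trace_mul_cfc _ _ hQ, Complex.ofReal_re,
    ← hS, ← Finset.sum_neg_distrib]
  exact Finset.sum_congr rfl fun i _ => by rw [Real.negMulLog, neg_mul]

/-! ### Correlation matrix and roughness of a Slater determinant. -/

lemma correlation_density (ψ : Finset (Fin M) → ℂ) (i j : Fin M) :
    correlation (density ψ) i j = star ψ ⬝ᵥ (create i *ᵥ (annihilate j *ᵥ ψ)) := by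
  rw [correlation, Matrix.of_apply, density, Matrix.vecMulVec_mul, Matrix.trace_vecMulVec,
    dotProduct_comm, ← Matrix.dotProduct_mulVec, Matrix.mulVec_mulVec]

lemma correlation_slater {N : ℕ} (v : Fin N → Fin M → ℂ)
    (hv : ∀ α β, star (v α) ⬝ᵥ v β = if α = β then 1 else 0) (i j : Fin M) :
    correlation (density (slater v)) i j = ∑ α, star (v α i) * v α j := by
  rw [correlation_density]
  set e : Fin M → ℂ := Pi.single i 1 with he
  -- `u` is the projection of the site state `e` onto the occupied orbitals. The remainder `e - u`
  -- is orthogonal to them and contributes nothing.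
  set u : Fin M → ℂ := ∑ α, star (v α i) • v α with hu
  have hw : (createVec (e - u))ᴴ *ᵥ slater v = 0 := by
    refine conjTranspose_createVec_mulVec_slater v fun β => ?_
    rw [star_sub, sub_dotProduct, he, hu, star_sum, sum_dotProduct]
    simp only [star_smul, smul_dotProduct, hv, star_star]
    simp
  have hcre : create i = createVec u + createVec (e - u) := by
    rw [← createVec_add, add_sub_cancel, he, createVec_single]
  have h1 : ∀ α, createVec (v α) *ᵥ (annihilate j *ᵥ slater v) = v α j • slater v := by
    intro α
    have h := conjTranspose_createVec_mul_add (Pi.single j 1) (v α)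
    rw [createVec_single] at h
    rw [Matrix.mulVec_mulVec, annihilate, eq_sub_of_add_eq' h, Matrix.sub_mulVec,
      ← Matrix.mulVec_mulVec _ _ (createVec _), createVec_mulVec_slater, Matrix.mulVec_zero,
      sub_zero, Matrix.smul_mulVec, Matrix.one_mulVec]
    simp
  have h2 : star (slater v) ⬝ᵥ (createVec (e - u) *ᵥ (annihilate j *ᵥ slater v)) = 0 := by
    rw [Matrix.dotProduct_mulVec, ← Matrix.conjTranspose_conjTranspose (createVec (e - u)),
      ← Matrix.star_mulVec, hw, star_zero, zero_dotProduct]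
  rw [hcre, Matrix.add_mulVec, dotProduct_add, h2, add_zero, hu]
  have h3 : createVec (∑ α, star (v α i) • v α) = ∑ α, star (v α i) • createVec (v α) := by
    have := map_sum (createLin M) (fun α => star (v α i) • v α) Finset.univ
    simp only [map_smul] at this
    exact this
  rw [h3, Matrix.sum_mulVec]
  simp only [Matrix.smul_mulVec, h1, dotProduct_sum, dotProduct_smul,
    star_slater_dotProduct_self hv, smul_eq_mul, mul_one]

/-- On the left half the correlation matrix is `Aᴴ * A`, with the left parts as rows of `A`;
cyclicity of the trace passes to the diagonal matrix `A * Aᴴ`. -/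
lemma roughnessSq_slater {N : ℕ} (v : Fin N → Fin M → ℂ) (l : Fin N → ℝ)
    (hv : ∀ α β, star (v α) ⬝ᵥ v β = if α = β then 1 else 0)
    (hL : ∀ α β, star (leftPart (v α)) ⬝ᵥ leftPart (v β) = if α = β then (l α : ℂ) else 0) :
    roughnessSq (density (slater v)) = ∑ α, l α * (1 - l α) := by
  let A : Matrix (Fin N) (Fin (M / 2)) ℂ := Matrix.of fun α => leftPart (v α)
  have hA : A * Aᴴ = Matrix.diagonal fun α => (l α : ℂ) := by
    ext α β
    have := hL β α
    rw [Matrix.mul_apply, Matrix.diagonal_apply]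
    simp only [eq_comm (a := α)]
    rw [dotProduct] at this
    trans
    · exact Finset.sum_congr rfl fun i _ => mul_comm _ _
    · refine this.trans ?_
      split_ifs with h
      · rw [h]
      · rfl
  have hD : ∀ i j, correlation (density (slater v)) (leftHalf M i) (leftHalf M j)
      = (Aᴴ * A) i j := by
    intro i j
    rw [correlation_slater v hv]
    rfl
  have h1 : ∑ j, (Aᴴ * A) j j = ∑ α, (l α : ℂ) := by
    have := Matrix.trace_mul_comm Aᴴ A
    rw [hA, Matrix.trace_diagonal] at this
    exact this
  have h2 : ∑ i, ∑ j, (Aᴴ * A) i j * (Aᴴ * A) j i = ∑ α, (l α : ℂ) * l α := by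
    have : (Aᴴ * A * (Aᴴ * A)).trace = (A * Aᴴ * (A * Aᴴ)).trace := by
      rw [Matrix.mul_assoc, Matrix.trace_mul_comm]
      simp only [Matrix.mul_assoc]
    rw [hA, Matrix.diagonal_mul_diagonal, Matrix.trace_diagonal] at this
    rw [← this]
    simp only [Matrix.trace, Matrix.diag, Matrix.mul_apply (M := Aᴴ * A)]
  rw [roughnessSq]
  simp only [hD]
  rw [h1, h2, ← Finset.sum_sub_distrib, Complex.re_sum]
  refine Finset.sum_congr rfl fun α _ => ?_
  rw [← Complex.ofReal_mul, ← Complex.ofReal_sub, Complex.ofReal_re]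
  ring

/-! ### Single-particle entanglement spectrum. -/

/-- Entropy and roughness of a Gaussian state in terms of the single-particle entanglement
spectrum. -/
lemma exists_entanglement_spectrum {N : ℕ} {G : Matrix (Fin M) (Fin N) ℂ} (hG : Gᴴ * G = 1) :
    ∃ l : Fin N → ℝ, (∀ α, 0 ≤ l α) ∧ (∀ α, l α ≤ 1) ∧
      roughnessSq (density (gaussianState G)) = ∑ α, l α * (1 - l α) ∧
      vonNeumannEntropy (reducedDensity (density (gaussianState G)))
        = ∑ α, Real.binEntropy (l α) := by
  let A : Matrix (Fin (M / 2)) (Fin N) ℂ := G.submatrix (leftHalf M) id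
  have hX : (Aᴴ * A).IsHermitian := Matrix.isHermitian_conjTranspose_mul_self A
  let U : Matrix (Fin N) (Fin N) ℂ := hX.eigenvectorUnitary
  have hU : Uᴴ * U = 1 := Unitary.coe_star_mul_self _
  have hdiag : Uᴴ * (Aᴴ * A) * U = Matrix.diagonal fun α => (hX.eigenvalues α : ℂ) := by
    have := hX.conjStarAlgAut_star_eigenvectorUnitary
    rw [Unitary.conjStarAlgAut_star_apply] at this
    exact this
  let v : Fin N → Fin M → ℂ := (G * U).col
  have hv : ∀ α β, star (v α) ⬝ᵥ v β = if α = β then 1 else 0 := by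
    intro α β
    have : ((G * U)ᴴ * (G * U)) α β = if α = β then 1 else 0 := by
      rw [Matrix.conjTranspose_mul, Matrix.mul_assoc, ← Matrix.mul_assoc Gᴴ, hG, Matrix.one_mul, hU,
        Matrix.one_apply]
    exact this
  have hL : ∀ α β, star (leftPart (v α)) ⬝ᵥ leftPart (v β)
      = if α = β then (hX.eigenvalues α : ℂ) else 0 := by
    intro α β
    have : ((A * U)ᴴ * (A * U)) α β = if α = β then (hX.eigenvalues α : ℂ) else 0 := by
      rw [Matrix.conjTranspose_mul, Matrix.mul_assoc, ← Matrix.mul_assoc Aᴴ, ← Matrix.mul_assoc,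
        hdiag, Matrix.diagonal_apply]
    exact this
  -- The two Gram matrices add up to the identity, so diagonalizing the left one diagonalizes the
  -- right one.
  have hR : ∀ α β, star (rightPart (v α)) ⬝ᵥ rightPart (v β)
      = if α = β then ((1 - hX.eigenvalues α : ℝ) : ℂ) else 0 := by
    intro α β
    have h := star_rightPart_dotProduct_add (v α) (v β)
    rw [hL, hv] at h
    rw [eq_sub_of_add_eq' h]
    split_ifs <;> simp
  have hpos : ∀ {K : ℕ} (w : Fin K → ℂ) (r : ℝ), star w ⬝ᵥ w = (r : ℂ) → 0 ≤ r := by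
    intro K w r h
    have h2 := congrArg Complex.re h
    rw [Complex.ofReal_re, dotProduct, Complex.re_sum] at h2
    rw [← h2]
    refine Finset.sum_nonneg fun i _ => ?_
    rw [Pi.star_apply, Complex.star_def, ← Complex.normSq_eq_conj_mul_self, Complex.ofReal_re]
    exact Complex.normSq_nonneg _
  have hl0 : ∀ α, 0 ≤ hX.eigenvalues α := fun α => hpos _ _ ((hL α α).trans (if_pos rfl))
  have hl1 : ∀ α, hX.eigenvalues α ≤ 1 := fun α =>
    sub_nonneg.1 (hpos _ _ ((hR α α).trans (if_pos rfl)))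
  refine ⟨hX.eigenvalues, hl0, hl1, ?_, ?_⟩
  · rw [← density_gaussianState_mul G hU, gaussianState_eq_slater]
    exact roughnessSq_slater v _ hv hL
  · rw [← density_gaussianState_mul G hU, gaussianState_eq_slater]
    exact vonNeumannEntropy_slater v _ hl0 hl1 hL hR

/-! ### Binary entropy against variance. -/

lemma mul_one_sub_le_negMulLog {x : ℝ} (hx : 0 ≤ x) : x * (1 - x) ≤ Real.negMulLog x := by
  rcases hx.eq_or_lt with rfl | hx
  · simp
  · rw [Real.negMulLog, neg_mul, ← mul_neg]
    exact mul_le_mul_of_nonneg_left (by linarith [Real.log_le_sub_one_of_pos hx]) hx.le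

lemma negMulLog_le_one_sub {x : ℝ} (hx : 0 ≤ x) : Real.negMulLog x ≤ 1 - x := by
  rcases hx.eq_or_lt with rfl | hx
  · simp
  · have h := mul_le_mul_of_nonneg_left (Real.one_sub_inv_le_log_of_pos hx) hx.le
    rw [mul_sub, mul_inv_cancel₀ hx.ne', mul_one] at h
    rw [Real.negMulLog, neg_mul]
    linarith

lemma mul_one_sub_le_binEntropy {x : ℝ} (h0 : 0 ≤ x) (h1 : x ≤ 1) :
    x * (1 - x) ≤ Real.binEntropy x := by
  rw [Real.binEntropy_eq_negMulLog_add_negMulLog_one_sub]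
  linarith [mul_one_sub_le_negMulLog h0, Real.negMulLog_nonneg (sub_nonneg.2 h1) (by linarith)]

/-- The binary entropy is bounded by the variance up to a logarithmic factor and a small error. -/
lemma binEntropy_le {x K : ℝ} (h0 : 0 ≤ x) (h1 : x ≤ 1) (hK : 1 ≤ K) :
    Real.binEntropy x ≤ 2 * (Real.log K + 1) * (x * (1 - x)) + 1 / K := by
  wlog h : x ≤ 1 / 2 generalizing x
  · have := this (x := 1 - x) (by linarith) (by linarith) (by linarith)
    rw [Real.binEntropy_one_sub, sub_sub_cancel, mul_comm (1 - x)] at this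
    exact this
  have hK0 : 0 < K := by linarith
  have hlog : 0 ≤ Real.log K := Real.log_nonneg hK
  -- This is `negMulLog y ≤ 1 - y` at `y = K * x`, divided by `K`.
  have hA : Real.negMulLog x ≤ x * Real.log K + 1 / K := by
    have h2 := negMulLog_le_one_sub (mul_nonneg hK0.le h0)
    rw [Real.negMulLog_mul] at h2
    have h3 : K * Real.negMulLog x ≤ K * (x * Real.log K + 1 / K) := by
      rw [mul_add, mul_one_div_cancel hK0.ne']
      have h4 : Real.negMulLog K = -K * Real.log K := rfl
      rw [h4] at h2
      nlinarith [mul_nonneg hK0.le h0]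
    exact le_of_mul_le_mul_left h3 hK0
  have hB : Real.negMulLog (1 - x) ≤ x := by
    linarith [negMulLog_le_one_sub (sub_nonneg.2 h1)]
  have hx : x ≤ 2 * (x * (1 - x)) := by nlinarith
  rw [Real.binEntropy_eq_negMulLog_add_negMulLog_one_sub]
  nlinarith [mul_le_mul_of_nonneg_right hx hlog]

/-! ### Comparison of entropy and roughness. -/

lemma card_le_of_isometry {N : ℕ} {G : Matrix (Fin M) (Fin N) ℂ} (hG : Gᴴ * G = 1) : N ≤ M := by
  have h := Matrix.rank_mul_le_right Gᴴ G
  rw [hG, Matrix.rank_one, Fintype.card_fin] at h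
  exact h.trans (by simpa using G.rank_le_card_height)

/-- The entanglement entropy of a Gaussian state is comparable to its squared roughness. -/
lemma roughnessSq_le_vonNeumannEntropy_le {N : ℕ} {G : Matrix (Fin M) (Fin N) ℂ}
    (hG : Gᴴ * G = 1) (hM : 1 ≤ M) :
    0 ≤ roughnessSq (density (gaussianState G)) ∧
      roughnessSq (density (gaussianState G))
        ≤ vonNeumannEntropy (reducedDensity (density (gaussianState G))) ∧
      vonNeumannEntropy (reducedDensity (density (gaussianState G)))
        ≤ 2 * (Real.log M + 1) * roughnessSq (density (gaussianState G)) + 1 := by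
  obtain ⟨l, h0, h1, hr, hS⟩ := exists_entanglement_spectrum hG
  -- The cutoff `K = M` makes the `N ≤ M` errors `1 / K` add up to at most one.
  have hM' : (1 : ℝ) ≤ M := by exact_mod_cast hM
  rw [hr, hS]
  refine ⟨Finset.sum_nonneg fun α _ => mul_nonneg (h0 α) (sub_nonneg.2 (h1 α)),
    Finset.sum_le_sum fun α _ => mul_one_sub_le_binEntropy (h0 α) (h1 α),
    (Finset.sum_le_sum fun α _ => binEntropy_le (h0 α) (h1 α) hM').trans ?_⟩
  rw [Finset.sum_add_distrib, ← Finset.mul_sum]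
  have hN : (N : ℝ) ≤ M := by exact_mod_cast card_le_of_isometry hG
  have : ∑ _α : Fin N, 1 / (M : ℝ) ≤ 1 := by
    rw [Finset.sum_const, Finset.card_univ, Fintype.card_fin, nsmul_eq_mul, mul_one_div]
    exact (div_le_one (by linarith)).2 hN
  linarith

lemma entanglementEntropy_bounds {N : ℕ} {Ω : Type*} [Fintype Ω] {p : Ω → ℝ} (hp : ∀ ω, 0 ≤ p ω)
    (hp1 : ∑ ω, p ω = 1) (ħ : ℝ) {H : Ω → Matrix (Fin M) (Fin M) ℂ}
    (hH : ∀ ω, (H ω).IsHermitian) {G : Matrix (Fin M) (Fin N) ℂ} (hG : Gᴴ * G = 1) (hM : 1 ≤ M)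
    (t : ℝ) :
    ∃ R : ℝ, 0 ≤ R ∧ wApp p ħ H G t = Real.sqrt R ∧ R ≤ entanglementEntropy p ħ H G t ∧
      entanglementEntropy p ħ H G t ≤ 2 * (Real.log M + 1) * R + 1 := by
  have key := fun ω => by
    have hGt : (NormedSpace.exp (-(Complex.I * ((t / ħ : ℝ) : ℂ)) • H ω) * G)ᴴ
        * (NormedSpace.exp (-(Complex.I * ((t / ħ : ℝ) : ℂ)) • H ω) * G) = 1 := by
      rw [Matrix.conjTranspose_mul, Matrix.mul_assoc, ← Matrix.mul_assoc _ _ G,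
        exp_neg_I_smul_isometry _ (hH ω), Matrix.one_mul, hG]
    have h := roughnessSq_le_vonNeumannEntropy_le hGt hM
    rwa [← state_eq_gaussianState] at h
  refine ⟨_, Finset.sum_nonneg fun ω _ => mul_nonneg (hp ω) (key ω).1, rfl,
    Finset.sum_le_sum fun ω _ => mul_le_mul_of_nonneg_left (key ω).2.1 (hp ω),
    (Finset.sum_le_sum fun ω _ => mul_le_mul_of_nonneg_left (key ω).2.2 (hp ω)).trans ?_⟩
  simp only [mul_add, mul_one, Finset.sum_add_distrib, hp1, mul_left_comm (p _), Finset.mul_sum]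
  exact le_rfl

/-! ### Asymptotics in the time window. -/

lemma eventually_log_lt {a u δ : ℝ} (hu : 0 < u) (hδ : 0 < δ) :
    ∀ᶠ M : ℕ in Filter.atTop, 0 < Real.log a + u * Real.log M ∧
      Real.log (2 * Real.log M + 3) < δ * (Real.log a + u * Real.log M) ∧ 0 ≤ Real.log M := by
  have hy : Filter.Tendsto (fun M : ℕ => Real.log M) Filter.atTop Filter.atTop :=
    Real.tendsto_log_atTop.comp tendsto_natCast_atTop_atTop
  have hz : Filter.Tendsto (fun M : ℕ => 2 * Real.log M + 3) Filter.atTop Filter.atTop :=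
    Filter.tendsto_atTop_add_const_right _ _ (hy.const_mul_atTop two_pos)
  -- With this constant `log (2 y + 3)` uses up `δ * u / 2 * y`, where `y = log M`; the other half
  -- of `δ * u * y` absorbs the constants.
  have hc : 0 < δ * u / 4 := by positivity
  have h1 := hz.eventually (Real.isLittleO_log_id_atTop.bound hc)
  filter_upwards [h1, hy.eventually_ge_atTop 0, hy.eventually_gt_atTop (-Real.log a / u),
    hy.eventually_gt_atTop ((δ * u / 4 * 3 - δ * Real.log a) / (δ * u / 2))] with M h1 h2 h3 h4
  refine ⟨?_, ?_, h2⟩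
  · rw [div_lt_iff₀ hu] at h3
    linarith
  · rw [div_lt_iff₀ (by positivity)] at h4
    simp only [id, Real.norm_eq_abs] at h1
    rw [abs_of_nonneg (by linarith : 0 ≤ 2 * Real.log M + 3)] at h1
    have := le_abs_self (Real.log (2 * Real.log M + 3))
    linarith

end FreeFermion

end

theorem mainTheorem1
    (ħ : ℝ) (hħ : 0 < ħ)
    (Ω : ℕ → Type*) [∀ M, Fintype (Ω M)]
    (p : ∀ M, Ω M → ℝ) (hp : ∀ M ω, 0 ≤ p M ω) (hp1 : ∀ M, ∑ ω, p M ω = 1)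
    (N : ℕ → ℕ)
    (H : ∀ M, Ω M → Matrix (Fin M) (Fin M) ℂ) (hH : ∀ M ω, (H M ω).IsHermitian)
    (G : ∀ M, Matrix (Fin M) (Fin (N M)) ℂ) (hG : ∀ M, (G M)ᴴ * G M = 1)
    (β a b u₁ u₂ : ℝ) (hβ : 0 < β) (ha : 0 < a) (hb : 0 < b) (hu₁ : 0 < u₁) (hu : u₁ < u₂)
    (hw : ∀ ε : ℝ, 0 < ε → ∃ M₀ : ℕ, ∀ M : ℕ, M₀ < M → Even M →
      ∀ t : ℝ, a * (M : ℝ) ^ u₁ < t → t < b * (M : ℝ) ^ u₂ →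
        |Real.log (FreeFermion.wApp (p M) ħ (H M) (G M) t) / Real.log t - β| < ε) :
    ∀ δ : ℝ, 0 < δ → ∃ M₁ : ℕ, ∀ M : ℕ, M₁ < M → Even M →
      ∀ t : ℝ, a * (M : ℝ) ^ u₁ < t → t < b * (M : ℝ) ^ u₂ →
        |Real.log (FreeFermion.entanglementEntropy (p M) ħ (H M) (G M) t) / Real.log t - 2 * β|
          < δ := by
  intro δ hδ
  -- The bound `β / 2` keeps `log R` positive. The bound `δ / 4` doubles to `δ / 2` because `log R =
  -- 2 log w`, leaving `δ / 2` for the logarithmic factor.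
  obtain ⟨M₀, hM₀⟩ := hw (min (β / 2) (δ / 4)) (by positivity)
  obtain ⟨M₂, hM₂⟩ := Filter.eventually_atTop.1
    (FreeFermion.eventually_log_lt (a := a) hu₁ (half_pos hδ))
  refine ⟨max M₀ M₂, fun M hM hMe t ht1 ht2 => ?_⟩
  have hMpos : 1 ≤ M := by omega
  have hMR : (0 : ℝ) < M := by exact_mod_cast hMpos
  have hwM := hM₀ M ((le_max_left _ _).trans_lt hM) hMe t ht1 ht2
  obtain ⟨hT, hlog, hlogM⟩ := hM₂ M ((le_max_right _ _).trans hM.le)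
  obtain ⟨R, hR0, hwR, hRS, hSR⟩ :=
    FreeFermion.entanglementEntropy_bounds (hp M) (hp1 M) ħ (hH M) (hG M) hMpos t
  set S := FreeFermion.entanglementEntropy (p M) ħ (H M) (G M) t
  have hTt : Real.log a + u₁ * Real.log M < Real.log t := by
    rw [← Real.log_rpow hMR, ← Real.log_mul ha.ne' (Real.rpow_pos_of_pos hMR _).ne']
    exact Real.log_lt_log (by positivity) ht1
  have ht : 0 < Real.log t := hT.trans hTt
  rw [hwR, Real.log_sqrt hR0, abs_sub_lt_iff, sub_lt_iff_lt_add, div_lt_iff₀ ht, sub_lt_comm,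
    lt_div_iff₀ ht] at hwM
  obtain ⟨hhi, hlo⟩ := hwM
  have hε1 := min_le_left (β / 2) (δ / 4)
  have hε2 := min_le_right (β / 2) (δ / 4)
  set ε := min (β / 2) (δ / 4)
  have hlogR : 0 < Real.log R := by nlinarith
  have hR1 : 1 < R := by
    by_contra h
    exact absurd (Real.log_nonpos hR0 (not_lt.1 h)) (not_le.2 hlogR)
  have hS1 : Real.log R ≤ Real.log S := Real.log_le_log (by linarith) hRS
  -- Since `R > 1`, the additive `1` is absorbed: `2 (log M + 1) R + 1 ≤ (2 log M + 3) R`.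
  have hS2 : Real.log S ≤ Real.log (2 * Real.log M + 3) + Real.log R := by
    rw [← Real.log_mul (by linarith) (by linarith)]
    exact Real.log_le_log (by linarith) (by nlinarith)
  rw [abs_sub_lt_iff, sub_lt_iff_lt_add, div_lt_iff₀ ht, sub_lt_comm, lt_div_iff₀ ht]
  constructor <;> nlinarith
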